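/- Let $S$ be a finite set and let $\mathcal M(S\times S)$ be the set of $\nu:S\times S\to[0,\infty)$ with $\sum_{i,j}\nu(i,j)=1$ and $\nu(k,*):=\sum_j\nu(k,j)=\sum_i\nu(i,k)$ for all $k\in S$. Put $\nu(j|i):=\nu(i,j)/\nu(i,*)$ if $\nu(i,*)>0$, and $\nu(j|i):=0$ for all $j$ otherwise; $S_\nu:=\{k:\nu(k,*)>0\}$. Write $\nu\preceq\theta$ if $\theta(i,j)=0$ implies $\nu(i,j)=0$ for all $i,j$. The relative entropy rate is $D(\nu\|\theta):=\sum_{i,j\in S_\nu}\nu(i,j)\log\frac{\nu(j|i)}{\theta(j|i)}$ if $\nu\preceq\theta$, with terms having $\nu(i,j)=0$ read as $0$, and $D(\nu\|\theta):=\infty$ otherwise. Let $\nu_n(i_1,\dots,i_n):=\nu(i_1,*)\prod_{k=1}^{n-1}\nu(i_{k+1}|i_k)$ be the law on $S^n$ of the stationary Markov chain defined by $\nu$. For probability mass functions $P,Q$ on a finite set and $\alpha>0$, $\alpha\ne1$, let $R_\alpha(P\|Q):=\infty$ if $\alpha>1$ and $P$ is not absolutely continuous with respect to $Q$, and $R_\alpha(P\|Q):=\frac1{\alpha(\alpha-1)}\log\sum_{x:P(x)Q(x)>0}\left(\frac{P(x)}{Q(x)}\right)^{\alpha}Q(x)$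 otherwise (with $\log 0=-\infty$); for $\alpha<0$ let $R_\alpha(P\|Q):=R_{1-\alpha}(Q\|P)$. Let $\alpha\in\mathbb R\setminus\{0,1\}$ and $\nu,\theta\in\mathcal M(S\times S)$. Then the Rényi divergence rate $R_\alpha(\nu\|\theta):=\lim_{n\to\infty}\frac1n R_\alpha(\nu_n\|\theta_n)$ exists in $[-\infty,\infty]$, and the following hold, where $\mu$ ranges over $\mathcal M(S\times S)$ and $\inf\emptyset=\infty$. 1. If $\alpha>1$, then $R_\alpha(\nu\|\theta)=\sup_{\mu\preceq\nu}\left(\frac1\alpha D(\mu\|\theta)-\frac1{\alpha-1}D(\mu\|\nu)\right)$. 2. If $0<\alpha<1$, then $R_\alpha(\nu\|\theta)=\inf_{\mu\preceq\nu,\ \mu\preceq\theta}\left(\frac1\alpha D(\mu\|\theta)-\frac1{\alpha-1}D(\mu\|\nu)\right)$. 3. If $\alpha<0$, then $R_\alpha(\nu\|\theta)=\sup_{\mu\preceq\theta}\left(\frac1\alpha D(\mu\|\theta)-\frac1{\alpha-1}D(\mu\|\nu)\right)$. In all three cases the extremum is attained by some $\mu$ in the indicated set, except when $0<\alpha<1$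 and there is no $\mu\in\mathcal M(S\times S)$ with $\mu\preceq\nu$ and $\mu\preceq\theta$. Moreover, if $\alpha>1$ and $\nu\preceq\theta$, or $0<\alpha<1$ and some $\mu$ satisfies $\mu\preceq\nu$ and $\mu\preceq\theta$, or $\alpha<0$ and $\theta\preceq\nu$, then an optimizer can be chosen of the following form. Let $m(i,j):=\nu(j|i)^\alpha\theta(j|i)^{1-\alpha}$ (read as $0$ if $\nu(j|i)=0$ or $\theta(j|i)=0$). There are a set $C\subseteq S$ such that the restriction of $m$ to $C\times C$ is irreducible, and vectors $u,w:S\to[0,\infty)$, zero off $C$ and strictly positive on $C$, which restrict to a left and a right (Perron–Frobenius) eigenvector of this restriction of $m$ for the same eigenvalue $r>0$, such that $\mu(i,j)=\frac1Z u(i)\,m(i,j)\,w(j)$ for all $i,j\in S$, with $Z=\sum_{i,j}u(i)\,m(i,j)\,w(j)$. -/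

import Mathlib

open Filter Topology

/-- The Rényi divergence of order `α > 0`, `α ≠ 1`, between two probability mass functions `P`, `Q`
on a finite set; the value is `∞` when `α > 1` and `P` is not absolutely continuous with respect to
`Q`. Here `ENNReal.log 0 = -∞`, so for `0 < α < 1` and disjoint supports the value is `∞`. -/
noncomputable def renyiDivPos {Ω : Type*} [Fintype Ω] (α : ℝ) (P Q : Ω → ℝ) : EReal :=
  open Classical in
  if 1 < α ∧ ¬ (∀ x, Q x = 0 → P x = 0) then ⊤
  else ((1 / (α * (α - 1)) : ℝ) : EReal) *
    ENNReal.log (ENNReal.ofReal (∑ x with 0 < P x * Q x, (P x / Q x) ^ α * Q x))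

/-- The Rényi divergence of order `α ∈ ℝ \ {0, 1}` between two probability mass functions on a
finite set; for `α < 0` it is `R_{1 - α}(Q ‖ P)`. -/
noncomputable def renyiDiv {Ω : Type*} [Fintype Ω] (α : ℝ) (P Q : Ω → ℝ) : EReal :=
  if α < 0 then renyiDivPos (1 - α) Q P else renyiDivPos α P Q

/-- The set `M(S × S)` of Markov probability distributions: probability mass functions on `S × S`
whose two marginals agree. -/
@[ext]
structure MarkovDist (S : Type*) [Fintype S] where
  /-- the mass of the pair `(i, j)` -/
  prob : S → S → ℝ
  prob_nonneg : ∀ i j, 0 ≤ prob i j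
  sum_prob : ∑ i, ∑ j, prob i j = 1
  marginal_eq : ∀ k, ∑ j, prob k j = ∑ i, prob i k

namespace MarkovDist

variable {S : Type*} [Fintype S]

/-- The marginal `ν(k, *)`. -/
def marginal (ν : MarkovDist S) (k : S) : ℝ := ∑ j, ν.prob k j

/-- The transition probability `ν(j | i)`, equal to `0` for all `j` if `ν(i, *) = 0`. -/
noncomputable def trans (ν : MarkovDist S) (i j : S) : ℝ :=
  if 0 < ν.marginal i then ν.prob i j / ν.marginal i else 0

/-- Absolute continuity `ν ⪯ θ`. -/
def AbsCont (ν θ : MarkovDist S) : Prop := ∀ i j, θ.prob i j = 0 → ν.prob i j = 0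

/-- The support `S_ν`. -/
noncomputable def support (ν : MarkovDist S) : Finset S := {k | 0 < ν.marginal k}

/-- The relative entropy (rate) `D(ν ‖ θ)`. -/
noncomputable def relEnt (ν θ : MarkovDist S) : EReal :=
  open Classical in
  if ν.AbsCont θ then
    ((∑ i ∈ ν.support, ∑ j ∈ ν.support,
      ν.prob i j * Real.log (ν.trans i j / θ.trans i j) : ℝ) : EReal)
  else ⊤

/-- The law of the first `n + 1` states of the stationary Markov chain defined by `ν`. -/
noncomputable def pathLaw (ν : MarkovDist S) (n : ℕ) (x : Fin (n + 1) → S) : ℝ :=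
  ν.marginal (x 0) * ∏ k : Fin n, ν.trans (x k.castSucc) (x k.succ)

/-- `1/N` times the Rényi divergence between the laws of the first `N = n + 1` states. -/
noncomputable def renyiPerStep (α : ℝ) (ν θ : MarkovDist S) (n : ℕ) : EReal :=
  ((1 / ((n : ℝ) + 1) : ℝ) : EReal) * renyiDiv α (ν.pathLaw n) (θ.pathLaw n)

/-- The Rényi divergence rate `R_α(ν ‖ θ)`, the limit of `renyiPerStep`. -/
noncomputable def renyiRate (α : ℝ) (ν θ : MarkovDist S) : EReal :=
  limUnder atTop (renyiPerStep α ν θ)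

/-- The expression `(1/α) D(μ ‖ θ) - (1/(α - 1)) D(μ ‖ ν)`. -/
noncomputable def objective (α : ℝ) (ν θ μ : MarkovDist S) : EReal :=
  ((1 / α : ℝ) : EReal) * μ.relEnt θ - ((1 / (α - 1) : ℝ) : EReal) * μ.relEnt ν

/-- The matrix `[ν(j|i)^α θ(j|i)^(1-α)]`. Lean's `0 ^ x = 0` for `x ≠ 0` makes an entry with
`ν(j|i) = 0` or `θ(j|i) = 0` equal to `0`. -/
noncomputable def tiltedMatrix (α : ℝ) (ν θ : MarkovDist S) : Matrix S S ℝ :=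
  Matrix.of fun i j => ν.trans i j ^ α * θ.trans i j ^ (1 - α)

/-- `μ(i,j) = u(i) m(i,j) w(j) / Z`, where `m` is the tilted matrix, the restriction of `m` to some
set `C` of states is irreducible, `u` and `w` vanish off `C` and restrict on `C` to strictly
positive left and right (Perron–Frobenius) eigenvectors of that restriction with a common
eigenvalue `r > 0`, and `Z` is the normalization. -/
def IsPerronTilt (α : ℝ) (ν θ μ : MarkovDist S) : Prop :=
  ∃ (C : Finset S) (r : ℝ) (u w : S → ℝ),
    ((tiltedMatrix α ν θ).submatrix (Subtype.val : C → S) Subtype.val).IsIrreducible ∧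
    0 < r ∧
    (∀ i ∈ C, 0 < u i ∧ 0 < w i) ∧
    (∀ i ∉ C, u i = 0 ∧ w i = 0) ∧
    (∀ j ∈ C, ∑ i ∈ C, u i * tiltedMatrix α ν θ i j = r * u j) ∧
    (∀ i ∈ C, ∑ j ∈ C, tiltedMatrix α ν θ i j * w j = r * w i) ∧
    ∀ i j, μ.prob i j = u i * tiltedMatrix α ν θ i j * w j /
      ∑ k, ∑ l, u k * tiltedMatrix α ν θ k l * w l

end MarkovDist

/-! On paths charged by both chains, `P ^ α * Q ^ (1 - α)` factorizes into an initial weight and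
entries of the tilted matrix `m`. The Rényi sum is therefore a path sum of `m`
(`sum_pathLaw_eq_pathSum`), and its exponential growth rate is `log r` with `r` the Perron value of
`m`. On the variational side, for `μ` dominated by both `ν` and `θ`, the objective is `1 / (α (α -
1))` times the free energy of `μ` with respect to `m` (`objective_of_absCont`). What remains is that
the free energy has maximum `log r`: a positive `v` with `m v ≤ s v` bounds it by `log s`
(`freeEnergy_le_log`), and the chain tilted by left and right eigenvectors reaches `log r`
(`exists_tilt`).

Since `m` may be reducible, `r` is obtained as a limit of Perron eigenvalues of positive
perturbations, which supplies such a `v` for every `s > r` (`exists_nonneg_eigenvector`); an index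
set minimal for carrying an eigenvector is then an irreducible class (`exists_perron_class`). The
same `v` and the eigenvector of that class squeeze the path sums between geometric sequences.

The sign of `1 / (α (α - 1))` decides between supremum and infimum. The case `α < 0` is the case `1
- α > 1` with `ν` and `θ` exchanged. -/

namespace Matrix

/-! ### Perron–Frobenius theory for nonnegative matrices -/

variable {ι : Type*} [Fintype ι]

/-- The **Perron theorem** for entrywise positive matrices: existence of a positive eigenvector. -/
theorem exists_pos_eigenvector_of_pos [Nonempty ι] (A : Matrix ι ι ℝ) (hA : ∀ i j, 0 < A i j) :
    ∃ (r : ℝ) (w : ι → ℝ), (∀ i, 0 < w i) ∧ w ∈ stdSimplex ℝ ι ∧ A *ᵥ w = r • w := by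
  classical
  have mulVec_pos : ∀ x : ι → ℝ, (∀ i, 0 ≤ x i) → x ≠ 0 → ∀ i, 0 < (A *ᵥ x) i := by
    intro x hx hx0 i
    obtain ⟨j, hj⟩ := Function.ne_iff.1 hx0
    exact Finset.sum_pos' (fun k _ => mul_nonneg (hA i k).le (hx k))
      ⟨j, Finset.mem_univ j, mul_pos (hA i j) (lt_of_le_of_ne (hx j) (Ne.symm hj))⟩
  set B : ℝ := ∑ i, ∑ j, A i j with hB
  -- Collatz–Wielandt: the eigenvalue is the largest `t` admitting a probability vector `x` with `t
  -- x ≤ A x`. Summing over coordinates shows that such a `t` is at most `B`, so the cap only serves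
  -- compactness.
  let K : Set (ℝ × (ι → ℝ)) :=
    (Set.Icc 0 B ×ˢ stdSimplex ℝ ι) ∩ {p | ∀ i, p.1 * p.2 i ≤ (A *ᵥ p.2) i}
  have hK : IsCompact K := by
    refine (isCompact_Icc.prod (isCompact_stdSimplex ℝ ι)).inter_right ?_
    simp only [Set.ofPred_forall]
    refine isClosed_iInter fun i => isClosed_le (by fun_prop) ?_
    simp only [mulVec, dotProduct]
    fun_prop
  have hB0 : 0 ≤ B := Finset.sum_nonneg fun i _ => Finset.sum_nonneg fun j _ => (hA i j).le
  obtain ⟨i₀⟩ := ‹Nonempty ι›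
  have hne : K.Nonempty := by
    refine ⟨(0, Pi.single i₀ 1), ⟨⟨le_rfl, hB0⟩, single_mem_stdSimplex ℝ i₀⟩, fun i => ?_⟩
    simp [(hA i i₀).le]
  obtain ⟨⟨t, x⟩, ⟨⟨⟨ht0, htB⟩, hx⟩, htx⟩, hmax⟩ := hK.exists_isMaxOn hne continuousOn_fst
  have hx0 : x ≠ 0 := by
    rintro rfl
    simpa using hx.2
  have hAx := mulVec_pos x hx.1 hx0
  have heq : A *ᵥ x = t • x := by
    by_contra hne'
    -- If `A x ≠ t x`, applying `A` once more makes the inequality strict in every coordinate. The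
    -- normalized vector `y` of `A x` then admits `t + δ`, against maximality.
    have hd := mulVec_pos (A *ᵥ x - t • x) (fun i => by simpa using htx i) (sub_ne_zero.2 hne')
    set s : ℝ := ∑ i, (A *ᵥ x) i with hs
    have hs0 : 0 < s := Finset.sum_pos (fun i _ => hAx i) ⟨i₀, Finset.mem_univ _⟩
    let y : ι → ℝ := s⁻¹ • (A *ᵥ x)
    have hy : y ∈ stdSimplex ℝ ι := by
      refine ⟨fun i => mul_nonneg (inv_nonneg.2 hs0.le) (hAx i).le, ?_⟩
      simp only [y, Pi.smul_apply, smul_eq_mul, ← Finset.mul_sum]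
      exact inv_mul_cancel₀ hs0.ne'
    have hy1 : ∀ i, y i ≤ 1 := fun i => by
      rw [← hy.2]
      exact Finset.single_le_sum (fun j _ => hy.1 j) (Finset.mem_univ i)
    have hgap : ∀ i, 0 < (A *ᵥ y) i - t * y i := fun i => by
      have h : (A *ᵥ y) i - t * y i = s⁻¹ * (A *ᵥ (A *ᵥ x - t • x)) i := by
        simp only [y, mulVec_smul, mulVec_sub, Pi.smul_apply, Pi.sub_apply, smul_eq_mul]
        ring
      rw [h]
      exact mul_pos (inv_pos.2 hs0) (hd i)
    obtain ⟨k, -, hk⟩ := Finset.exists_min_image Finset.univ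
      (fun i => (A *ᵥ y) i - t * y i) ⟨i₀, Finset.mem_univ _⟩
    set δ := (A *ᵥ y) k - t * y k with hδ
    have hδ0 : 0 < δ := hgap k
    have hle : ∀ i, (t + δ) * y i ≤ (A *ᵥ y) i := fun i => by
      have h1 := hk i (Finset.mem_univ i)
      have h2 : δ * y i ≤ δ * 1 := mul_le_mul_of_nonneg_left (hy1 i) hδ0.le
      linarith
    have hmem : (t + δ, y) ∈ K := by
      refine ⟨⟨⟨by linarith, ?_⟩, hy⟩, hle⟩
      calc t + δ = ∑ i, (t + δ) * y i := by rw [← Finset.mul_sum, hy.2, mul_one]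
        _ ≤ ∑ i, (A *ᵥ y) i := Finset.sum_le_sum fun i _ => hle i
        _ ≤ B := Finset.sum_le_sum fun i _ => Finset.sum_le_sum fun j _ =>
          mul_le_of_le_one_right (hA i j).le (hy1 j)
    have := hmax hmem
    simp only [Set.mem_ofPred_eq] at this
    linarith
  refine ⟨t, x, fun i => ?_, hx, heq⟩
  have := hAx i
  rw [heq] at this
  exact pos_of_mul_pos_right this ht0

/-- A nonnegative matrix has a nonnegative eigenvector whose eigenvalue `r` is the infimum of the
`s` for which a positive vector `v` with `A v ≤ s v` exists. -/
theorem exists_nonneg_eigenvector [Nonempty ι] (A : Matrix ι ι ℝ) (hA : ∀ i j, 0 ≤ A i j) :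
    ∃ (r : ℝ) (w : ι → ℝ), 0 ≤ r ∧ w ∈ stdSimplex ℝ ι ∧ A *ᵥ w = r • w ∧
      ∀ s, r < s → ∃ v : ι → ℝ, (∀ i, 0 < v i) ∧ ∀ i, (A *ᵥ v) i ≤ s * v i := by
  have hε : ∀ n : ℕ, (0 : ℝ) < 1 / ((n : ℝ) + 1) := fun n => Nat.one_div_pos_of_nat
  choose ρ w hwpos hwmem hweq using fun n : ℕ => exists_pos_eigenvector_of_pos
    (of fun i j => A i j + 1 / ((n : ℝ) + 1))
    (fun i j => add_pos_of_nonneg_of_pos (hA i j) (hε n))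
  -- The entries of `w n` sum to one, so the constant perturbation adds exactly `1 / (n + 1)` to
  -- each coordinate.
  have hval : ∀ n i, (A *ᵥ w n) i + 1 / ((n : ℝ) + 1) = ρ n * w n i := fun n i => by
    have h := congrFun (hweq n) i
    simp only [mulVec, dotProduct, of_apply, add_mul, Finset.sum_add_distrib, ← Finset.mul_sum,
      (hwmem n).2, mul_one, Pi.smul_apply, smul_eq_mul] at h
    exact h
  obtain ⟨x, hx, φ, hφ, hlim⟩ := (isCompact_stdSimplex ℝ ι).tendsto_subseq hwmem
  have hεlim : Tendsto (fun n => 1 / ((φ n : ℝ) + 1)) atTop (𝓝 0) :=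
    tendsto_one_div_add_atTop_nhds_zero_nat.comp hφ.tendsto_atTop
  have hAlim : ∀ i, Tendsto (fun n => (A *ᵥ w (φ n)) i) atTop (𝓝 ((A *ᵥ x) i)) := fun i => by
    have hc : Continuous fun y : ι → ℝ => (A *ᵥ y) i := by
      simp only [mulVec, dotProduct]
      fun_prop
    exact (hc.tendsto x).comp hlim
  -- Written as a sum of coordinates, the eigenvalues converge along with the eigenvectors.
  have hρ : ∀ n, ρ n = ∑ i, ((A *ᵥ w n) i + 1 / ((n : ℝ) + 1)) := fun n => by
    simp_rw [hval n, ← Finset.mul_sum, (hwmem n).2, mul_one]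
  set r : ℝ := ∑ i, (A *ᵥ x) i
  have hρlim : Tendsto (fun n => ρ (φ n)) atTop (𝓝 r) := by
    simp_rw [hρ]
    refine tendsto_finsetSum _ fun i _ => ?_
    simpa using (hAlim i).add hεlim
  refine ⟨r, x, Finset.sum_nonneg fun i _ => Finset.sum_nonneg fun j _ =>
    mul_nonneg (hA i j) (hx.1 j), hx, ?_, fun s hs => ?_⟩
  · ext i
    have h1 := (hAlim i).add hεlim
    have h2 := hρlim.mul ((continuous_apply i).tendsto x |>.comp hlim)
    simp only [add_zero] at h1
    refine tendsto_nhds_unique h1 (h2.congr fun n => ?_)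
    exact (hval (φ n) i).symm
  -- The limit vector may have zeros, but the eigenvectors of the perturbed matrices are positive
  -- and their eigenvalues eventually drop below `s`.
  · obtain ⟨n, hn⟩ := (hρlim.eventually (gt_mem_nhds hs)).exists
    refine ⟨w (φ n), hwpos _, fun i => ?_⟩
    have h1 := hval (φ n) i
    have h2 := hε (φ n)
    have h3 := mul_le_mul_of_nonneg_right hn.le (hwpos (φ n) i).le
    linarith

/-- Induction along a path, walking backwards from `j`. It is used to spread a zero of a left
eigenvector to all indices. -/
theorem IsIrreducible.forall_of_forall_pred {n : Type*} {A : Matrix n n ℝ} (hA : A.IsIrreducible)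
    {P : n → Prop} (hP : ∀ i j, 0 < A i j → P j → P i) {j : n} (hj : P j) (i : n) : P i := by
  let : Quiver n := toQuiver A
  have key : ∀ j (p : Quiver.Path i j), P j → P i := by
    intro j p
    induction p with
    | nil => exact id
    | cons q e ih => exact fun h => ih (hP _ _ e.down h)
  obtain ⟨p, -⟩ := hA.connected i j
  exact key j p hj

/-- An irreducible matrix with a positive right eigenvector has a positive left eigenvector for the
same eigenvalue. -/
theorem IsIrreducible.exists_pos_left_eigenvector [Nonempty ι] {A : Matrix ι ι ℝ}
    (hA : A.IsIrreducible) {r : ℝ} {w : ι → ℝ} (hw : ∀ i, 0 < w i) (hAw : A *ᵥ w = r • w) :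
    ∃ u : ι → ℝ, (∀ i, 0 < u i) ∧ u ᵥ* A = r • u := by
  obtain ⟨r', u, -, hu, huA, -⟩ := exists_nonneg_eigenvector Aᵀ fun i j => hA.nonneg j i
  rw [mulVec_transpose] at huA
  obtain ⟨k, hk⟩ : ∃ k, 0 < u k := by
    by_contra! h
    have : ∑ i, u i ≤ 0 := Finset.sum_nonpos fun i _ => h i
    rw [hu.2] at this
    linarith
  have hpair : 0 < u ⬝ᵥ w := Finset.sum_pos' (fun i _ => mul_nonneg (hu.1 i) (hw i).le)
    ⟨k, Finset.mem_univ k, mul_pos hk (hw k)⟩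
  -- Evaluating `u A w` from the left and from the right gives `r'` and `r` times the same positive
  -- number.
  have hr : r' = r := by
    have h := dotProduct_mulVec u A w
    rw [huA, hAw, dotProduct_smul, smul_dotProduct, smul_eq_mul, smul_eq_mul] at h
    exact (mul_right_cancel₀ hpair.ne' h).symm
  subst hr
  refine ⟨u, fun j => ?_, huA⟩
  by_contra hj
  have hj0 : u j = 0 := le_antisymm (not_lt.1 hj) (hu.1 j)
  refine hk.ne' (hA.forall_of_forall_pred (P := fun i => u i = 0) (fun i j hij hj => ?_) hj0 k)
  have h := congrFun huA j
  rw [Pi.smul_apply, hj, smul_zero] at h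
  have h2 := (Finset.sum_eq_zero_iff_of_nonneg
    (fun i _ => mul_nonneg (hu.1 i) (hA.nonneg i j))).1 h i (Finset.mem_univ i)
  exact (mul_eq_zero.1 h2).resolve_right hij.ne'

/-- **Perron–Frobenius** for a nonnegative matrix `A` with spectral radius `r`: if `r > 0`, then
`r` is the Perron–Frobenius eigenvalue of an irreducible principal submatrix. -/
theorem exists_perron_class [Nonempty ι] (A : Matrix ι ι ℝ) (hA : ∀ i j, 0 ≤ A i j) :
    ∃ r : ℝ, 0 ≤ r ∧
      (∀ s, r < s → ∃ v : ι → ℝ, (∀ i, 0 < v i) ∧ ∀ i, ∑ j, A i j * v j ≤ s * v i) ∧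
      (0 < r → ∃ (C : Finset ι) (u w : ι → ℝ), C.Nonempty ∧
        (A.submatrix (Subtype.val : C → ι) Subtype.val).IsIrreducible ∧
        (∀ i ∈ C, 0 < u i ∧ 0 < w i) ∧ (∀ i ∉ C, u i = 0 ∧ w i = 0) ∧
        (∀ j ∈ C, ∑ i ∈ C, u i * A i j = r * u j) ∧
        (∀ i ∈ C, ∑ j ∈ C, A i j * w j = r * w i)) := by
  classical
  obtain ⟨r, x, hr, hx, hAx, hsup⟩ := exists_nonneg_eigenvector A hA
  refine ⟨r, hr, hsup, fun hr0 => ?_⟩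
  -- Take `C` minimal among the sets on which the restricted matrix still has a nonzero nonnegative
  -- eigenvector for `r`. Minimality forces positivity of the eigenvector on `C` and the absence of
  -- proper successor-closed subsets.
  let E : Finset ι → Prop := fun C => ∃ w : ι → ℝ, (∀ i, 0 ≤ w i) ∧ (∃ i ∈ C, w i ≠ 0) ∧
    ∀ i ∈ C, ∑ j ∈ C, A i j * w j = r * w i
  have hE : ∃ C, E C := by
    refine ⟨Finset.univ, x, hx.1, ?_, fun i _ => congrFun hAx i⟩
    by_contra! h
    have := hx.2
    rw [Finset.sum_eq_zero fun i hi => h i hi] at this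
    exact zero_ne_one this
  obtain ⟨C, ⟨w, hw, ⟨k, hkC, hk⟩, hAw⟩, hmin⟩ := exists_minimal_of_wellFoundedLT E hE
  have hsub : ∀ K ⊆ C, E K → K = C := fun K hKC hK => hKC.antisymm (hmin hK hKC)
  have hwpos : ∀ i ∈ C, 0 < w i := by
    have h : C.filter (fun i => w i ≠ 0) = C := by
      refine hsub _ (Finset.filter_subset _ _) ⟨w, hw, ⟨k, by simp [hkC, hk], hk⟩, fun i hi => ?_⟩
      rw [← hAw i (Finset.filter_subset _ _ hi), Finset.sum_filter]
      refine Finset.sum_congr rfl fun j _ => ?_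
      split_ifs with hj
      · rfl
      · rw [not_not.1 hj, mul_zero]
    intro i hi
    rw [← h, Finset.mem_filter] at hi
    exact lt_of_le_of_ne (hw i) hi.2.symm
  have hclosed : ∀ K ⊆ C, K.Nonempty → (∀ i ∈ K, ∀ j ∈ C, 0 < A i j → j ∈ K) → K = C := by
    intro K hKC ⟨i, hi⟩ hcl
    refine hsub K hKC ⟨w, hw, ⟨i, hi, (hwpos i (hKC hi)).ne'⟩, fun i hi => ?_⟩
    rw [← hAw i (hKC hi)]
    refine Finset.sum_subset hKC fun j hj hjK => ?_
    have : ¬ 0 < A i j := fun h => hjK (hcl i hi j hj h)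
    rw [le_antisymm (not_lt.1 this) (hA i j), zero_mul]
  set N := A.submatrix (Subtype.val : C → ι) Subtype.val with hN
  have hirr : N.IsIrreducible := by
    let : Quiver C := toQuiver N
    refine ⟨fun i j => hA _ _, fun i j => ?_⟩
    -- The set reached from `i` by paths of positive length is closed under successors. It is
    -- nonempty because `r * w i > 0` forces an outgoing edge, which is where `0 < r` enters.
    let R : C → Prop := fun j => ∃ p : Quiver.Path i j, 0 < p.length
    have hRC : (Finset.univ.filter R).map (Function.Embedding.subtype _) = C := by
      refine hclosed _ ?_ ?_ ?_
      · intro j hj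
        obtain ⟨j', -, rfl⟩ := Finset.mem_map.1 hj
        exact j'.2
      · have h : ∑ j ∈ C, A i j * w j ≠ 0 := by
          rw [hAw i i.2]
          exact (mul_pos hr0 (hwpos i i.2)).ne'
        obtain ⟨j, hj, hne⟩ := Finset.exists_ne_zero_of_sum_ne_zero h
        have hpos : 0 < N i ⟨j, hj⟩ := lt_of_le_of_ne (hA _ _) (left_ne_zero_of_mul hne).symm
        exact ⟨j, Finset.mem_map.2 ⟨⟨j, hj⟩, Finset.mem_filter.2
          ⟨Finset.mem_univ _, ⟨Quiver.Path.nil.cons ⟨hpos⟩, Nat.succ_pos _⟩⟩, rfl⟩⟩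
      · intro a ha b hb hab
        obtain ⟨a', ha', rfl⟩ := Finset.mem_map.1 ha
        obtain ⟨p, -⟩ := (Finset.mem_filter.1 ha').2
        exact Finset.mem_map.2 ⟨⟨b, hb⟩, Finset.mem_filter.2
          ⟨Finset.mem_univ _, ⟨p.cons ⟨hab⟩, Nat.succ_pos _⟩⟩, rfl⟩
    obtain ⟨j', hj', he⟩ := Finset.mem_map.1 (hRC.ge j.2)
    obtain rfl : j' = j := Subtype.ext he
    exact (Finset.mem_filter.1 hj').2
  have : Nonempty C := ⟨⟨k, hkC⟩⟩
  obtain ⟨u, hu, huN⟩ := hirr.exists_pos_left_eigenvector (r := r) (w := fun i : C => w i)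
    (fun i => hwpos i i.2) (by
      ext i
      have := hAw i i.2
      rw [← Finset.sum_coe_sort] at this
      exact this)
  refine ⟨C, fun i => if h : i ∈ C then u ⟨i, h⟩ else 0, fun i => if i ∈ C then w i else 0,
    ⟨k, hkC⟩, hirr, fun i hi => ?_, fun i hi => ?_, fun j hj => ?_, fun i hi => ?_⟩
  · simp [hi, hu, hwpos i hi]
  · simp [hi]
  · have h := congrFun huN ⟨j, hj⟩
    rw [← Finset.sum_coe_sort]
    simpa [hj, vecMul, dotProduct, hN] using h
  · simp only [if_pos hi]
    rw [← hAw i hi]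
    exact Finset.sum_congr rfl fun j hj => by rw [if_pos hj]

end Matrix

/-! ### Path sums and their geometric bounds -/

namespace Matrix

variable {ι : Type*} [Fintype ι]

/-- The total weight of the paths with `n` steps, for initial weights `a`, transition weights `A`
and terminal weights `g`. -/
noncomputable def pathSum (A : Matrix ι ι ℝ) (a g : ι → ℝ) (n : ℕ) : ℝ :=
  ∑ x : Fin (n + 1) → ι, a (x 0) * (∏ k : Fin n, A (x k.castSucc) (x k.succ)) * g (x (Fin.last n))

theorem pathSum_zero (A : Matrix ι ι ℝ) (a g : ι → ℝ) : A.pathSum a g 0 = ∑ i, a i * g i := by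
  rw [pathSum, ← (Equiv.funUnique (Fin 1) ι).symm.sum_comp]
  simp

/-- Summing out the last state replaces the terminal weight `g` by `A g`, so that one-step
inequalities for `A v` iterate by induction. -/
theorem pathSum_succ (A : Matrix ι ι ℝ) (a g : ι → ℝ) (n : ℕ) :
    A.pathSum a g (n + 1) = A.pathSum a (fun i => ∑ j, A i j * g j) n := by
  rw [pathSum, pathSum, ← (Fin.snocEquiv fun _ : Fin (n + 2) => ι).sum_comp, Fintype.sum_prod_type,
    Finset.sum_comm]
  refine Finset.sum_congr rfl fun x _ => ?_
  rw [Finset.mul_sum]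
  refine Finset.sum_congr rfl fun j _ => ?_
  have h0 : (Fin.snoc x j : Fin (n + 2) → ι) 0 = x 0 := Fin.snoc_castSucc (α := fun _ => ι) j x 0
  rw [Fin.prod_univ_castSucc]
  simp only [Fin.snocEquiv, Equiv.coe_fn_mk, h0, Fin.snoc_castSucc, Fin.succ_last, Fin.snoc_last,
    Fin.succ_castSucc]
  ring

theorem pathSum_mono {A : Matrix ι ι ℝ} (hA : ∀ i j, 0 ≤ A i j) {a : ι → ℝ} (ha : ∀ i, 0 ≤ a i)
    {g h : ι → ℝ} (hgh : ∀ i, g i ≤ h i) (n : ℕ) : A.pathSum a g n ≤ A.pathSum a h n :=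
  Finset.sum_le_sum fun _ _ => mul_le_mul_of_nonneg_left (hgh _)
    (mul_nonneg (ha _) (Finset.prod_nonneg fun _ _ => hA _ _))

theorem pathSum_const_mul (A : Matrix ι ι ℝ) (a g : ι → ℝ) (c : ℝ) (n : ℕ) :
    A.pathSum a (fun i => c * g i) n = c * A.pathSum a g n := by
  rw [pathSum, pathSum, Finset.mul_sum]
  exact Finset.sum_congr rfl fun _ _ => by ring

theorem pathSum_le_pow {A : Matrix ι ι ℝ} (hA : ∀ i j, 0 ≤ A i j) {a : ι → ℝ} (ha : ∀ i, 0 ≤ a i)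
    {v : ι → ℝ} {s : ℝ} (hs : 0 ≤ s) (hv : ∀ i, ∑ j, A i j * v j ≤ s * v i) (n : ℕ) :
    A.pathSum a v n ≤ s ^ n * ∑ i, a i * v i := by
  induction n with
  | zero => rw [pathSum_zero, pow_zero, one_mul]
  | succ n ih =>
    calc A.pathSum a v (n + 1) ≤ s * A.pathSum a v n := by
          rw [pathSum_succ, ← pathSum_const_mul]
          exact pathSum_mono hA ha hv n
      _ ≤ s * (s ^ n * ∑ i, a i * v i) := mul_le_mul_of_nonneg_left ih hs
      _ = s ^ (n + 1) * ∑ i, a i * v i := by ring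

theorem pow_le_pathSum {A : Matrix ι ι ℝ} (hA : ∀ i j, 0 ≤ A i j) {a : ι → ℝ} (ha : ∀ i, 0 ≤ a i)
    {v : ι → ℝ} {s : ℝ} (hs : 0 ≤ s) (hv : ∀ i, s * v i ≤ ∑ j, A i j * v j) (n : ℕ) :
    s ^ n * ∑ i, a i * v i ≤ A.pathSum a v n := by
  induction n with
  | zero => rw [pathSum_zero, pow_zero, one_mul]
  | succ n ih =>
    calc s ^ (n + 1) * ∑ i, a i * v i = s * (s ^ n * ∑ i, a i * v i) := by ring
      _ ≤ s * A.pathSum a v n := mul_le_mul_of_nonneg_left ih hs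
      _ ≤ A.pathSum a v (n + 1) := by
          rw [pathSum_succ, ← pathSum_const_mul]
          exact pathSum_mono hA ha hv n

theorem exists_pathSum_one_le {A : Matrix ι ι ℝ} (hA : ∀ i j, 0 ≤ A i j) {a : ι → ℝ}
    (ha : ∀ i, 0 ≤ a i) {v : ι → ℝ} (hv0 : ∀ i, 0 < v i) {s : ℝ} (hs : 0 ≤ s)
    (hv : ∀ i, ∑ j, A i j * v j ≤ s * v i) :
    ∃ c : ℝ, 0 < c ∧ ∀ n, A.pathSum a (fun _ => 1) n ≤ c * s ^ n := by
  -- With this constant `b v ≥ 1` in every coordinate, so the terminal weight `1` is dominated by a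
  -- multiple of `v`. The later `+ 1` keeps the bound positive even if `a` vanishes.
  set b : ℝ := ∑ i, (v i)⁻¹
  have hb0 : 0 ≤ b := Finset.sum_nonneg fun i _ => (inv_pos.2 (hv0 i)).le
  have hb : ∀ i, (1 : ℝ) ≤ b * v i := fun i => by
    rw [← inv_mul_cancel₀ (hv0 i).ne']
    exact mul_le_mul_of_nonneg_right (Finset.single_le_sum
      (f := fun i => (v i)⁻¹) (fun j _ => (inv_pos.2 (hv0 j)).le) (Finset.mem_univ i)) (hv0 i).le
  have hsum : 0 ≤ ∑ i, a i * v i := Finset.sum_nonneg fun i _ => mul_nonneg (ha i) (hv0 i).le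
  refine ⟨b * (∑ i, a i * v i) + 1, by positivity, fun n => ?_⟩
  calc A.pathSum a (fun _ => 1) n ≤ b * A.pathSum a v n := by
        rw [← pathSum_const_mul]
        exact pathSum_mono hA ha hb n
    _ ≤ b * (s ^ n * ∑ i, a i * v i) :=
        mul_le_mul_of_nonneg_left (pathSum_le_pow hA ha hs hv n) hb0
    _ ≤ (b * (∑ i, a i * v i) + 1) * s ^ n := by
        have := pow_nonneg hs n
        linarith

theorem exists_le_pathSum_one {A : Matrix ι ι ℝ} (hA : ∀ i j, 0 ≤ A i j) {a : ι → ℝ}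
    (ha : ∀ i, 0 ≤ a i) {w : ι → ℝ} (hw0 : ∀ i, 0 ≤ w i) (haw : 0 < ∑ i, a i * w i) {s : ℝ}
    (hs : 0 ≤ s) (hw : ∀ i, s * w i ≤ ∑ j, A i j * w j) :
    ∃ c : ℝ, 0 < c ∧ ∀ n, c * s ^ n ≤ A.pathSum a (fun _ => 1) n := by
  set b : ℝ := ∑ i, w i + 1
  have hb0 : 0 < b := add_pos_of_nonneg_of_pos (Finset.sum_nonneg fun i _ => hw0 i) one_pos
  have hb : ∀ i, b⁻¹ * w i ≤ 1 := fun i => by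
    rw [inv_mul_le_one₀ hb0]
    have := Finset.single_le_sum (fun j _ => hw0 j) (Finset.mem_univ i)
    linarith
  refine ⟨b⁻¹ * ∑ i, a i * w i, by positivity, fun n => ?_⟩
  calc b⁻¹ * (∑ i, a i * w i) * s ^ n = b⁻¹ * (s ^ n * ∑ i, a i * w i) := by ring
    _ ≤ b⁻¹ * A.pathSum a w n :=
        mul_le_mul_of_nonneg_left (pow_le_pathSum hA ha hs hw n) (inv_pos.2 hb0).le
    _ ≤ A.pathSum a (fun _ => 1) n := by
        rw [← pathSum_const_mul]
        exact pathSum_mono hA ha hb n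

end Matrix

/-! ### Exponential growth rates in the extended reals -/

theorem tendsto_inv_mul_log_geometric (c s : ℝ) :
    Tendsto (fun n : ℕ => 1 / ((n : ℝ) + 1) * (Real.log c + n * Real.log s)) atTop
      (𝓝 (Real.log s)) := by
  have h := tendsto_one_div_add_atTop_nhds_zero_nat (𝕜 := ℝ)
  have h2 := (h.mul_const (Real.log c - Real.log s)).add_const (Real.log s)
  rw [zero_mul, zero_add] at h2
  refine h2.congr fun n => ?_
  have : (n : ℝ) + 1 ≠ 0 := by positivity
  field_simp
  ring

/-- The exponential growth rate of a sequence squeezed between geometric sequences. -/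
theorem tendsto_inv_mul_log_of_geometric_bounds {Z : ℕ → ℝ} {r : ℝ} (hr : 0 ≤ r)
    (hlow : 0 < r → ∃ c : ℝ, 0 < c ∧ ∀ n, c * r ^ n ≤ Z n)
    (hup : ∀ s, r < s → ∃ c : ℝ, 0 < c ∧ ∀ n, Z n ≤ c * s ^ n) :
    Tendsto (fun n : ℕ => ((1 / ((n : ℝ) + 1) : ℝ) : EReal) * ENNReal.log (ENNReal.ofReal (Z n)))
      atTop (𝓝 (ENNReal.log (ENNReal.ofReal r))) := by
  have hlog : ∀ {c s : ℝ}, 0 < c → 0 < s → ∀ n : ℕ,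
      Real.log (c * s ^ n) = Real.log c + n * Real.log s := fun hc hs n => by
    rw [Real.log_mul hc.ne' (pow_pos hs n).ne', Real.log_pow]
  -- When `r = 0` the terms `Z n` may vanish. The guard `0 < Z n` excludes them here, and they are
  -- treated separately as `⊥`.
  have hupper : ∀ s, r < s → ∀ y, Real.log s < y → ∀ᶠ n : ℕ in atTop, 0 < Z n →
      1 / ((n : ℝ) + 1) * Real.log (Z n) < y := by
    intro s hs y hy
    obtain ⟨c, hc, hZ⟩ := hup s hs
    filter_upwards [(tendsto_inv_mul_log_geometric c s).eventually (gt_mem_nhds hy)] with n hn hpos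
    refine lt_of_le_of_lt (mul_le_mul_of_nonneg_left ?_ (by positivity)) hn
    rw [← hlog hc (hr.trans_lt hs)]
    exact Real.log_le_log hpos (hZ n)
  rcases hr.eq_or_lt with rfl | hr0
  · rw [ENNReal.ofReal_zero, ENNReal.log_zero, EReal.tendsto_nhds_bot_iff_real]
    intro y
    filter_upwards [hupper (Real.exp (y - 1)) (Real.exp_pos _) y (by rw [Real.log_exp]; linarith)]
      with n hn
    rcases le_or_gt (Z n) 0 with h | h
    · rw [ENNReal.ofReal_of_nonpos h, ENNReal.log_zero,
        EReal.coe_mul_bot_of_pos (by positivity)]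
      exact EReal.bot_lt_coe y
    · rw [ENNReal.log_ofReal_of_pos h, ← EReal.coe_mul]
      exact EReal.coe_lt_coe_iff.2 (hn h)
  · obtain ⟨c, hc, hZ⟩ := hlow hr0
    have hpos : ∀ n, 0 < Z n := fun n => (mul_pos hc (pow_pos hr0 n)).trans_le (hZ n)
    rw [ENNReal.log_ofReal_of_pos hr0]
    simp_rw [fun n => ENNReal.log_ofReal_of_pos (hpos n), ← EReal.coe_mul]
    refine EReal.tendsto_coe.2 (tendsto_order.2 ⟨fun y hy => ?_, fun y hy => ?_⟩)
    · filter_upwards [(tendsto_inv_mul_log_geometric c r).eventually (lt_mem_nhds hy)] with n hn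
      refine lt_of_lt_of_le hn (mul_le_mul_of_nonneg_left ?_ (by positivity))
      rw [← hlog hc hr0]
      exact Real.log_le_log (mul_pos hc (pow_pos hr0 n)) (hZ n)
    · have hexp : r < Real.exp ((Real.log r + y) / 2) := by
        rw [← Real.log_lt_iff_lt_exp hr0]
        linarith
      filter_upwards [hupper _ hexp y (by rw [Real.log_exp]; linarith)] with n hn
      exact hn (hpos n)

/-! ### Markov distributions and the free energy -/

namespace MarkovDist

variable {S : Type*} [Fintype S]

theorem marginal_nonneg (ν : MarkovDist S) (i : S) : 0 ≤ ν.marginal i :=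
  Finset.sum_nonneg fun j _ => ν.prob_nonneg i j

theorem prob_le_marginal (ν : MarkovDist S) (i j : S) : ν.prob i j ≤ ν.marginal i :=
  Finset.single_le_sum (fun k _ => ν.prob_nonneg i k) (Finset.mem_univ j)

theorem prob_le_marginal_right (ν : MarkovDist S) (i j : S) : ν.prob i j ≤ ν.marginal j := by
  rw [marginal, ν.marginal_eq]
  exact Finset.single_le_sum (f := fun k => ν.prob k j) (fun k _ => ν.prob_nonneg k j)
    (Finset.mem_univ i)

theorem trans_nonneg (ν : MarkovDist S) (i j : S) : 0 ≤ ν.trans i j := by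
  unfold trans
  split_ifs with h
  · exact div_nonneg (ν.prob_nonneg i j) h.le
  · exact le_rfl

theorem trans_pos_iff (ν : MarkovDist S) {i j : S} : 0 < ν.trans i j ↔ 0 < ν.prob i j := by
  unfold trans
  split_ifs with h
  · exact div_pos_iff_of_pos_right h
  · exact iff_of_false (lt_irrefl _) fun h' => h (h'.trans_le (ν.prob_le_marginal i j))

theorem trans_eq_zero_iff (ν : MarkovDist S) {i j : S} : ν.trans i j = 0 ↔ ν.prob i j = 0 := by
  rw [← not_iff_not, ← ne_eq, ← ne_eq, ← (ν.trans_nonneg i j).lt_iff_ne', trans_pos_iff,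
    (ν.prob_nonneg i j).lt_iff_ne']

theorem marginal_mul_trans (ν : MarkovDist S) (i j : S) :
    ν.marginal i * ν.trans i j = ν.prob i j := by
  unfold trans
  split_ifs with h
  · exact mul_div_cancel₀ _ h.ne'
  · rw [mul_zero]
    exact (le_antisymm ((ν.prob_le_marginal i j).trans (not_lt.1 h)) (ν.prob_nonneg i j)).symm

theorem sum_marginal (ν : MarkovDist S) : ∑ i, ν.marginal i = 1 := ν.sum_prob

theorem nonempty_of_markovDist (ν : MarkovDist S) : Nonempty S := by
  by_contra h
  rw [not_nonempty_iff] at h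
  simpa using ν.sum_prob

theorem AbsCont.refl (ν : MarkovDist S) : ν.AbsCont ν := fun _ _ h => h

theorem AbsCont.trans {μ ν θ : MarkovDist S} (h : μ.AbsCont ν) (h' : ν.AbsCont θ) : μ.AbsCont θ :=
  fun i j hij => h i j (h' i j hij)

theorem AbsCont.prob_pos {μ ν : MarkovDist S} (h : μ.AbsCont ν) {i j : S} (hμ : 0 < μ.prob i j) :
    0 < ν.prob i j :=
  lt_of_le_of_ne (ν.prob_nonneg i j) fun h0 => hμ.ne' (h i j h0.symm)

theorem AbsCont.marginal_eq_zero {μ ν : MarkovDist S} (h : μ.AbsCont ν) {i : S}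
    (hi : ν.marginal i = 0) : μ.marginal i = 0 :=
  Finset.sum_eq_zero fun j _ => h i j (le_antisymm (hi ▸ ν.prob_le_marginal i j) (ν.prob_nonneg i j))

/-- Stationarity: the increment of a function of the state has mean zero. -/
theorem sum_prob_mul_sub (μ : MarkovDist S) (f : S → ℝ) :
    ∑ i, ∑ j, μ.prob i j * (f j - f i) = 0 := by
  simp_rw [mul_sub, Finset.sum_sub_distrib]
  rw [sub_eq_zero, Finset.sum_comm]
  refine Finset.sum_congr rfl fun k _ => ?_
  rw [← Finset.sum_mul, ← Finset.sum_mul, μ.marginal_eq]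

theorem sum_prob_mul_const (μ : MarkovDist S) (c : ℝ) : ∑ i, ∑ j, μ.prob i j * c = c := by
  simp_rw [← Finset.sum_mul]
  rw [μ.sum_prob, one_mul]

theorem tiltedMatrix_apply (α : ℝ) (ν θ : MarkovDist S) (i j : S) :
    tiltedMatrix α ν θ i j = ν.trans i j ^ α * θ.trans i j ^ (1 - α) := rfl

theorem tiltedMatrix_nonneg (α : ℝ) (ν θ : MarkovDist S) (i j : S) :
    0 ≤ tiltedMatrix α ν θ i j :=
  mul_nonneg (Real.rpow_nonneg (ν.trans_nonneg i j) _) (Real.rpow_nonneg (θ.trans_nonneg i j) _)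

theorem tiltedMatrix_pos_iff {α : ℝ} (hα0 : α ≠ 0) (hα1 : α ≠ 1) {ν θ : MarkovDist S} {i j : S} :
    0 < tiltedMatrix α ν θ i j ↔ 0 < ν.prob i j ∧ 0 < θ.prob i j := by
  have h1 : (1 : ℝ) - α ≠ 0 := sub_ne_zero.2 hα1.symm
  rw [(tiltedMatrix_nonneg α ν θ i j).lt_iff_ne', tiltedMatrix_apply, mul_ne_zero_iff,
    Real.rpow_ne_zero (ν.trans_nonneg i j) hα0, Real.rpow_ne_zero (θ.trans_nonneg i j) h1,
    Ne, Ne, trans_eq_zero_iff, trans_eq_zero_iff, (ν.prob_nonneg i j).lt_iff_ne',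
    (θ.prob_nonneg i j).lt_iff_ne']

/-- The free energy `∑ μ(i,j) log (A(i,j) / μ(j|i))` of a Markov distribution with respect to a
nonnegative matrix. -/
noncomputable def freeEnergy (A : Matrix S S ℝ) (μ : MarkovDist S) : ℝ :=
  ∑ i, ∑ j, μ.prob i j * Real.log (A i j / μ.trans i j)

/-- A positive vector `v` with `A v ≤ s v` bounds the free energy by `log s`. -/
theorem freeEnergy_le_log {A : Matrix S S ℝ} (hA : ∀ i j, 0 ≤ A i j) {μ : MarkovDist S}
    (hμ : ∀ i j, 0 < μ.prob i j → 0 < A i j) {v : S → ℝ} (hv : ∀ i, 0 < v i) {s : ℝ} (hs : 0 < s)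
    (hAv : ∀ i, ∑ j, A i j * v j ≤ s * v i) : freeEnergy A μ ≤ Real.log s := by
  have hterm : ∀ i j, μ.prob i j * Real.log (A i j / μ.trans i j) ≤
      μ.marginal i * (A i j * v j / (s * v i)) - μ.prob i j * 1 -
        μ.prob i j * (Real.log (v j) - Real.log (v i)) + μ.prob i j * Real.log s := by
    intro i j
    rcases (μ.prob_nonneg i j).eq_or_lt with h | h
    · rw [← h]
      have : 0 ≤ μ.marginal i * (A i j * v j / (s * v i)) :=
        mul_nonneg (μ.marginal_nonneg i)
          (div_nonneg (mul_nonneg (hA i j) (hv j).le) (mul_pos hs (hv i)).le)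
      simpa using this
    · have hp := μ.trans_pos_iff.2 h
      have ha := hμ i j h
      have hvi := hv i
      have hvj := hv j
      -- The inequality `log x ≤ x - 1` compares `μ(j|i)` with the substochastic kernel `A i j * v j
      -- / (s * v i)`. The differences `log (v j) - log (v i)` average to zero by stationarity.
      have hlog := Real.log_le_sub_one_of_pos
        (x := A i j / μ.trans i j * (v j / v i) / s) (by positivity)
      rw [Real.log_div (by positivity) hs.ne', Real.log_mul (by positivity) (by positivity),
        Real.log_div hvj.ne' hvi.ne'] at hlog
      have h2 := mul_le_mul_of_nonneg_left hlog h.le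
      have h3 : μ.prob i j * (A i j / μ.trans i j * (v j / v i) / s) =
          μ.marginal i * (A i j * v j / (s * v i)) := by
        rw [← μ.marginal_mul_trans]
        field_simp
      linarith
  have hle : ∀ i, μ.marginal i * ∑ j, A i j * v j / (s * v i) ≤ μ.marginal i := fun i => by
    rw [← Finset.sum_div]
    exact mul_le_of_le_one_right (μ.marginal_nonneg i)
      ((div_le_one (mul_pos hs (hv i))).2 (hAv i))
  have hsum := Finset.sum_le_sum fun i (_ : i ∈ Finset.univ) =>
    Finset.sum_le_sum fun j (_ : j ∈ Finset.univ) => hterm i j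
  simp_rw [Finset.sum_add_distrib, Finset.sum_sub_distrib] at hsum
  rw [μ.sum_prob_mul_const, μ.sum_prob_mul_const, μ.sum_prob_mul_sub fun i => Real.log (v i)]
    at hsum
  have h1 := Finset.sum_le_sum fun i (_ : i ∈ Finset.univ) => hle i
  simp_rw [Finset.mul_sum] at h1
  rw [μ.sum_marginal] at h1
  rw [freeEnergy]
  linarith

/-- Let `s` decrease to `r` in `freeEnergy_le_log`. The exponential form stays meaningful at `r =
0`, where it rules out any such `μ`. -/
theorem exp_freeEnergy_le {A : Matrix S S ℝ} (hA : ∀ i j, 0 ≤ A i j) {r : ℝ} (hr : 0 ≤ r)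
    (hsup : ∀ s, r < s → ∃ v : S → ℝ, (∀ i, 0 < v i) ∧ ∀ i, ∑ j, A i j * v j ≤ s * v i)
    {μ : MarkovDist S} (hμ : ∀ i j, 0 < μ.prob i j → 0 < A i j) :
    Real.exp (freeEnergy A μ) ≤ r := by
  refine le_of_forall_gt_imp_ge_of_dense fun s hs => ?_
  obtain ⟨v, hv, hAv⟩ := hsup s hs
  have hs0 := hr.trans_lt hs
  rw [← Real.le_log_iff_exp_le hs0]
  exact freeEnergy_le_log hA hμ hv hs0 hAv

/-- Left and right eigenvectors of a class of a nonnegative matrix give a Markov distribution whose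
free energy is the logarithm of the eigenvalue. -/
theorem exists_tilt {A : Matrix S S ℝ} (hA : ∀ i j, 0 ≤ A i j) {r : ℝ} (hr : 0 < r)
    {C : Finset S} {u w : S → ℝ} (hC : C.Nonempty) (hpos : ∀ i ∈ C, 0 < u i ∧ 0 < w i)
    (hzero : ∀ i ∉ C, u i = 0 ∧ w i = 0) (hu : ∀ j ∈ C, ∑ i ∈ C, u i * A i j = r * u j)
    (hw : ∀ i ∈ C, ∑ j ∈ C, A i j * w j = r * w i) :
    ∃ μ : MarkovDist S, (∀ i j, μ.prob i j = u i * A i j * w j / ∑ k, ∑ l, u k * A k l * w l) ∧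
      (∀ i j, 0 < μ.prob i j → 0 < A i j) ∧ freeEnergy A μ = Real.log r := by
  classical
  have hu0 : ∀ i, 0 ≤ u i := fun i =>
    if h : i ∈ C then (hpos i h).1.le else (hzero i h).1.ge
  have hw0 : ∀ i, 0 ≤ w i := fun i =>
    if h : i ∈ C then (hpos i h).2.le else (hzero i h).2.ge
  have hrow : ∀ i, ∑ j, u i * A i j * w j = r * (u i * w i) := fun i => by
    by_cases hi : i ∈ C
    · have h : ∑ j, A i j * w j = r * w i := by
        rw [← hw i hi]
        exact (Finset.sum_subset (Finset.subset_univ C) fun j _ hj => by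
          rw [(hzero j hj).2, mul_zero]).symm
      simp_rw [mul_assoc, ← Finset.mul_sum]
      rw [h]
      ring
    · simp [(hzero i hi).1]
  have hcol : ∀ j, ∑ i, u i * A i j * w j = r * (u j * w j) := fun j => by
    by_cases hj : j ∈ C
    · have h : ∑ i, u i * A i j = r * u j := by
        rw [← hu j hj]
        exact (Finset.sum_subset (Finset.subset_univ C) fun i _ hi => by
          rw [(hzero i hi).1, zero_mul]).symm
      rw [← Finset.sum_mul, h]
      ring
    · simp [(hzero j hj).2]
  set Z := ∑ k, ∑ l, u k * A k l * w l with hZ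
  have hZ0 : 0 < Z := by
    obtain ⟨k, hk⟩ := hC
    simp_rw [hZ, hrow, ← Finset.mul_sum]
    exact mul_pos hr (Finset.sum_pos' (fun i _ => mul_nonneg (hu0 i) (hw0 i))
      ⟨k, Finset.mem_univ k, mul_pos (hpos k hk).1 (hpos k hk).2⟩)
  let μ : MarkovDist S :=
    { prob := fun i j => u i * A i j * w j / Z
      prob_nonneg := fun i j =>
        div_nonneg (mul_nonneg (mul_nonneg (hu0 i) (hA i j)) (hw0 j)) hZ0.le
      sum_prob := by
        simp_rw [← Finset.sum_div]
        exact div_self hZ0.ne'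
      marginal_eq := fun k => by simp_rw [← Finset.sum_div, hrow, hcol] }
  have hprob : ∀ i j, μ.prob i j = u i * A i j * w j / Z := fun _ _ => rfl
  have hfactors : ∀ i j, 0 < μ.prob i j → 0 < u i ∧ 0 < A i j ∧ 0 < w i ∧ 0 < w j := by
    intro i j h
    have hne : u i * A i j * w j ≠ 0 := fun h0 => by
      rw [hprob, h0, zero_div] at h
      exact lt_irrefl _ h
    have hi : i ∈ C := by
      by_contra hi
      exact hne (by rw [(hzero i hi).1, zero_mul, zero_mul])
    exact ⟨(hpos i hi).1, lt_of_le_of_ne (hA i j) (right_ne_zero_of_mul (left_ne_zero_of_mul hne)).symm,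
      (hpos i hi).2, lt_of_le_of_ne (hw0 j) (right_ne_zero_of_mul hne).symm⟩
  refine ⟨μ, hprob, fun i j h => (hfactors i j h).2.1, ?_⟩
  have hmarg : ∀ i, μ.marginal i = r * (u i * w i) / Z := fun i => by
    simp_rw [marginal, hprob, ← Finset.sum_div, hrow]
  have hterm : ∀ i j, μ.prob i j * Real.log (A i j / μ.trans i j) =
      μ.prob i j * Real.log r - μ.prob i j * (Real.log (w j) - Real.log (w i)) := by
    intro i j
    rcases (μ.prob_nonneg i j).eq_or_lt with h | h
    · simp [← h]
    · obtain ⟨h1, h2, h3, h4⟩ := hfactors i j h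
      have hm : 0 < μ.marginal i := h.trans_le (μ.prob_le_marginal i j)
      -- The tilted chain is the Doob transform `μ(j|i) = A i j * w j / (r * w i)`: its log-ratio to
      -- `A` is `log r` up to a coboundary.
      have : A i j / μ.trans i j = r * w i / w j := by
        rw [trans, if_pos hm, hmarg, hprob]
        field_simp
      rw [this, Real.log_div (by positivity) h4.ne', Real.log_mul hr.ne' h3.ne']
      ring
  simp_rw [freeEnergy, hterm, Finset.sum_sub_distrib]
  rw [μ.sum_prob_mul_const, μ.sum_prob_mul_sub fun i => Real.log (w i), sub_zero]

end MarkovDist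

/-! ### The objective and the Rényi sums in terms of the tilted matrix -/

namespace MarkovDist

variable {S : Type*} [Fintype S]

theorem relEnt_of_absCont {μ θ : MarkovDist S} (h : μ.AbsCont θ) :
    μ.relEnt θ = ((∑ i, ∑ j, μ.prob i j * Real.log (μ.trans i j / θ.trans i j) : ℝ) : EReal) := by
  have hout : ∀ i j, i ∉ μ.support ∨ j ∉ μ.support → μ.prob i j = 0 := by
    intro i j hij
    simp only [support, Finset.mem_filter, Finset.mem_univ, true_and, not_lt] at hij
    refine le_antisymm ?_ (μ.prob_nonneg i j)
    rcases hij with h | h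
    · exact (μ.prob_le_marginal i j).trans h
    · exact (μ.prob_le_marginal_right i j).trans h
  rw [relEnt, if_pos h, EReal.coe_eq_coe_iff]
  refine (Finset.sum_congr rfl fun i _ => Finset.sum_subset (Finset.subset_univ _)
    fun j _ hj => by rw [hout i j (Or.inr hj), zero_mul]).trans ?_
  exact Finset.sum_subset (Finset.subset_univ _) fun i _ hi =>
    Finset.sum_eq_zero fun j _ => by rw [hout i j (Or.inl hi), zero_mul]

/-- In `(1/α) log (μ/θ) - (1/(α-1)) log (μ/ν)` the coefficients of the three logarithms, multiplied
by `α (α - 1)`, are `-1` for `μ`, `α` for `ν` and `1 - α` for `θ`. -/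
theorem objective_of_absCont {α : ℝ} (hα0 : α ≠ 0) (hα1 : α ≠ 1) {ν θ μ : MarkovDist S}
    (hν : μ.AbsCont ν) (hθ : μ.AbsCont θ) :
    objective α ν θ μ =
      ((1 / (α * (α - 1)) * freeEnergy (tiltedMatrix α ν θ) μ : ℝ) : EReal) := by
  have h1 : α - 1 ≠ 0 := sub_ne_zero.2 hα1
  rw [objective, relEnt_of_absCont hν, relEnt_of_absCont hθ, ← EReal.coe_mul, ← EReal.coe_mul,
    ← EReal.coe_sub, EReal.coe_eq_coe_iff, freeEnergy]
  simp_rw [Finset.mul_sum, ← Finset.sum_sub_distrib]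
  refine Finset.sum_congr rfl fun i _ => Finset.sum_congr rfl fun j _ => ?_
  rcases (μ.prob_nonneg i j).eq_or_lt with h | h
  · simp [← h]
  · have hp := μ.trans_pos_iff.2 h
    have hn := ν.trans_pos_iff.2 (hν.prob_pos h)
    have ht := θ.trans_pos_iff.2 (hθ.prob_pos h)
    rw [tiltedMatrix_apply, Real.log_div hp.ne' ht.ne', Real.log_div hp.ne' hn.ne',
      Real.log_div (by positivity) hp.ne', Real.log_mul (by positivity) (by positivity),
      Real.log_rpow hn, Real.log_rpow ht]
    field_simp
    ring

theorem pathLaw_nonneg (ν : MarkovDist S) (n : ℕ) (x : Fin (n + 1) → S) : 0 ≤ ν.pathLaw n x :=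
  mul_nonneg (ν.marginal_nonneg _) (Finset.prod_nonneg fun _ _ => ν.trans_nonneg _ _)

theorem AbsCont.pathLaw_eq_zero {ν θ : MarkovDist S} (h : ν.AbsCont θ) {n : ℕ}
    {x : Fin (n + 1) → S} (hx : θ.pathLaw n x = 0) : ν.pathLaw n x = 0 := by
  rcases mul_eq_zero.1 hx with h0 | h0
  · rw [pathLaw, h.marginal_eq_zero h0, zero_mul]
  · obtain ⟨k, hk, h1⟩ := Finset.prod_eq_zero_iff.1 h0
    rw [pathLaw, Finset.prod_eq_zero hk, mul_zero]
    exact ν.trans_eq_zero_iff.2 (h _ _ (θ.trans_eq_zero_iff.1 h1))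

/-- If `ν` is not absolutely continuous with respect to `θ`, neither is the law of a path with at
least one step. -/
theorem exists_pathLaw_ne_zero {ν θ : MarkovDist S} (h : ¬ ν.AbsCont θ) (n : ℕ) :
    ∃ x, θ.pathLaw (n + 1) x = 0 ∧ ν.pathLaw (n + 1) x ≠ 0 := by
  simp only [AbsCont, not_forall] at h
  obtain ⟨i, j, hθ, hν⟩ := h
  have hν' : 0 < ν.prob i j := lt_of_le_of_ne (ν.prob_nonneg i j) (Ne.symm hν)
  -- By stationarity a state that is entered with positive mass has positive marginal and hence a
  -- successor. The offending edge `(i, j)` thus extends to a `ν`-path of any length.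
  have hnext : ∀ k, ∃ l, 0 < ν.marginal k → 0 < ν.prob k l := fun k => by
    by_cases hk : 0 < ν.marginal k
    · obtain ⟨l, -, hl⟩ := Finset.exists_ne_zero_of_sum_ne_zero hk.ne'
      exact ⟨l, fun _ => lt_of_le_of_ne (ν.prob_nonneg k l) hl.symm⟩
    · exact ⟨k, fun h => absurd h hk⟩
  choose next hnext using hnext
  let y : ℕ → S := fun k => Nat.casesOn k i fun l => next^[l] j
  have hmarg : ∀ l, 0 < ν.marginal (y (l + 1)) := fun l => by
    induction l with
    | zero => exact hν'.trans_le (ν.prob_le_marginal_right i j)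
    | succ l ih =>
      have : y (l + 1 + 1) = next (y (l + 1)) := Function.iterate_succ_apply' next l j
      rw [this]
      exact (hnext _ ih).trans_le (ν.prob_le_marginal_right _ _)
  have hstep : ∀ k, 0 < ν.prob (y k) (y (k + 1)) := fun k => by
    cases k with
    | zero => exact hν'
    | succ l =>
      have : y (l + 1 + 1) = next (y (l + 1)) := Function.iterate_succ_apply' next l j
      rw [this]
      exact hnext _ (hmarg l)
  refine ⟨fun k => y k, ?_, ?_⟩
  · rw [pathLaw, Finset.prod_eq_zero (Finset.mem_univ 0), mul_zero]
    exact θ.trans_eq_zero_iff.2 hθ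
  · refine (mul_pos (hν'.trans_le (ν.prob_le_marginal i j)) (Finset.prod_pos fun k _ => ?_)).ne'
    exact ν.trans_pos_iff.2 (hstep k)

/-- Each summand is `P ^ α * Q ^ (1 - α)`, a product over the steps. Paths outside the filter
contribute `0` on the right because both exponents are nonzero. -/
theorem sum_pathLaw_eq_pathSum {α : ℝ} (hα0 : α ≠ 0) (hα1 : α ≠ 1) (ν θ : MarkovDist S) (n : ℕ)
    [DecidablePred fun x => 0 < ν.pathLaw n x * θ.pathLaw n x] :
    ∑ x with 0 < ν.pathLaw n x * θ.pathLaw n x,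
        (ν.pathLaw n x / θ.pathLaw n x) ^ α * θ.pathLaw n x =
      (tiltedMatrix α ν θ).pathSum (fun i => ν.marginal i ^ α * θ.marginal i ^ (1 - α))
        (fun _ => 1) n := by
  have h1 : (1 : ℝ) - α ≠ 0 := sub_ne_zero.2 hα1.symm
  rw [Finset.sum_filter, Matrix.pathSum]
  refine Finset.sum_congr rfl fun x _ => ?_
  have hfac : ν.marginal (x 0) ^ α * θ.marginal (x 0) ^ (1 - α) *
      (∏ k : Fin n, tiltedMatrix α ν θ (x k.castSucc) (x k.succ)) * 1 =
      ν.pathLaw n x ^ α * θ.pathLaw n x ^ (1 - α) := by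
    rw [pathLaw, pathLaw, Real.mul_rpow (ν.marginal_nonneg _)
        (Finset.prod_nonneg fun _ _ => ν.trans_nonneg _ _),
      Real.mul_rpow (θ.marginal_nonneg _) (Finset.prod_nonneg fun _ _ => θ.trans_nonneg _ _),
      ← Real.finsetProd_rpow _ _ fun _ _ => ν.trans_nonneg _ _,
      ← Real.finsetProd_rpow _ _ fun _ _ => θ.trans_nonneg _ _]
    simp_rw [tiltedMatrix_apply, Finset.prod_mul_distrib]
    ring
  rw [hfac]
  have hP := ν.pathLaw_nonneg n x
  have hQ := θ.pathLaw_nonneg n x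
  rcases hP.eq_or_lt with hP0 | hP0
  · simp [← hP0, Real.zero_rpow hα0]
  rcases hQ.eq_or_lt with hQ0 | hQ0
  · simp [← hQ0, Real.zero_rpow h1]
  rw [if_pos (mul_pos hP0 hQ0), Real.div_rpow hP hQ, Real.rpow_sub hQ0, Real.rpow_one]
  field_simp

theorem renyiPerStep_eq {α : ℝ} (hα0 : 0 < α) (hα1 : α ≠ 1) {ν θ : MarkovDist S}
    (h : 1 < α → ν.AbsCont θ) (n : ℕ) :
    renyiPerStep α ν θ n = ((1 / (α * (α - 1)) : ℝ) : EReal) *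
      (((1 / ((n : ℝ) + 1) : ℝ) : EReal) * ENNReal.log (ENNReal.ofReal
        ((tiltedMatrix α ν θ).pathSum (fun i => ν.marginal i ^ α * θ.marginal i ^ (1 - α))
          (fun _ => 1) n))) := by
  rw [renyiPerStep, renyiDiv, if_neg hα0.not_gt, renyiDivPos,
    if_neg fun hc => hc.2 fun x hx => (h hc.1).pathLaw_eq_zero hx,
    sum_pathLaw_eq_pathSum hα0.ne' hα1, mul_left_comm]

/-! ### The Perron value and the variational formulas -/

/-- The spectral radius `r` of the tilted matrix governs both the growth of the Rényi sums and the
free energies of Markov distributions. -/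
theorem exists_perron_value {α : ℝ} (hα0 : α ≠ 0) (hα1 : α ≠ 1) (ν θ : MarkovDist S) :
    ∃ r : ℝ, 0 ≤ r ∧
      Tendsto (fun n : ℕ => ((1 / ((n : ℝ) + 1) : ℝ) : EReal) * ENNReal.log (ENNReal.ofReal
        ((tiltedMatrix α ν θ).pathSum (fun i => ν.marginal i ^ α * θ.marginal i ^ (1 - α))
          (fun _ => 1) n))) atTop (𝓝 (ENNReal.log (ENNReal.ofReal r))) ∧
      (∀ μ : MarkovDist S, μ.AbsCont ν → μ.AbsCont θ →
        Real.exp (freeEnergy (tiltedMatrix α ν θ) μ) ≤ r) ∧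
      (0 < r → ∃ μ : MarkovDist S, μ.AbsCont ν ∧ μ.AbsCont θ ∧
        freeEnergy (tiltedMatrix α ν θ) μ = Real.log r ∧ IsPerronTilt α ν θ μ) := by
  have := ν.nonempty_of_markovDist
  set A := tiltedMatrix α ν θ with hAdef
  have hA : ∀ i j, 0 ≤ A i j := tiltedMatrix_nonneg α ν θ
  have hApos : ∀ {i j}, 0 < A i j ↔ 0 < ν.prob i j ∧ 0 < θ.prob i j :=
    tiltedMatrix_pos_iff hα0 hα1
  have ha : ∀ i, 0 ≤ ν.marginal i ^ α * θ.marginal i ^ (1 - α) := fun i =>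
    mul_nonneg (Real.rpow_nonneg (ν.marginal_nonneg i) _)
      (Real.rpow_nonneg (θ.marginal_nonneg i) _)
  obtain ⟨r, hr, hsup, hclass⟩ := A.exists_perron_class hA
  refine ⟨r, hr, tendsto_inv_mul_log_of_geometric_bounds hr (fun hr0 => ?_) fun s hs => ?_,
    fun μ hν hθ => exp_freeEnergy_le hA hr hsup fun i j h =>
      hApos.2 ⟨hν.prob_pos h, hθ.prob_pos h⟩, fun hr0 => ?_⟩
  · obtain ⟨C, u, w, ⟨k, hk⟩, -, hpos, hzero, -, hw⟩ := hclass hr0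
    have hw0 : ∀ i, 0 ≤ w i := fun i => by
      by_cases h : i ∈ C
      · exact (hpos i h).2.le
      · exact (hzero i h).2.ge
    refine Matrix.exists_le_pathSum_one hA ha hw0 ?_ hr fun i => ?_
    · have hne : ∑ j ∈ C, A k j * w j ≠ 0 := by
        rw [hw k hk]
        exact (mul_pos hr0 (hpos k hk).2).ne'
      obtain ⟨j, -, hj⟩ := Finset.exists_ne_zero_of_sum_ne_zero hne
      obtain ⟨h1, h2⟩ := hApos.1 (lt_of_le_of_ne (hA k j) (left_ne_zero_of_mul hj).symm)
      exact Finset.sum_pos' (fun i _ => mul_nonneg (ha i) (hw0 i)) ⟨k, Finset.mem_univ k,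
        mul_pos (mul_pos (Real.rpow_pos_of_pos (h1.trans_le (ν.prob_le_marginal k j)) _)
          (Real.rpow_pos_of_pos (h2.trans_le (θ.prob_le_marginal k j)) _)) (hpos k hk).2⟩
    · by_cases hi : i ∈ C
      · rw [← hw i hi]
        exact Finset.sum_le_sum_of_subset_of_nonneg (Finset.subset_univ C)
          fun j _ _ => mul_nonneg (hA i j) (hw0 j)
      · rw [(hzero i hi).2, mul_zero]
        exact Finset.sum_nonneg fun j _ => mul_nonneg (hA i j) (hw0 j)
  · obtain ⟨v, hv, hAv⟩ := hsup s hs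
    exact Matrix.exists_pathSum_one_le hA ha hv (hr.trans hs.le) hAv
  · obtain ⟨C, u, w, hC, hirr, hpos, hzero, hu, hw⟩ := hclass hr0
    obtain ⟨μ, hμ, hμA, hfree⟩ := exists_tilt hA hr0 hC hpos hzero hu hw
    have habs : ∀ i j, ¬ 0 < A i j → μ.prob i j = 0 := fun i j h =>
      le_antisymm (not_lt.1 fun h' => h (hμA i j h')) (μ.prob_nonneg i j)
    exact ⟨μ, fun i j h => habs i j fun h' => (hApos.1 h').1.ne' h,
      fun i j h => habs i j fun h' => (hApos.1 h').2.ne' h, hfree,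
      C, r, u, w, hirr, hr0, hpos, hzero, hu, hw, hμ⟩

theorem tendsto_renyiPerStep {α : ℝ} (hα0 : 0 < α) (hα1 : α ≠ 1) {ν θ : MarkovDist S}
    (h : 1 < α → ν.AbsCont θ) {L : EReal}
    (hL : Tendsto (fun n : ℕ => ((1 / ((n : ℝ) + 1) : ℝ) : EReal) * ENNReal.log (ENNReal.ofReal
        ((tiltedMatrix α ν θ).pathSum (fun i => ν.marginal i ^ α * θ.marginal i ^ (1 - α))
          (fun _ => 1) n))) atTop (𝓝 L)) :
    Tendsto (renyiPerStep α ν θ) atTop (𝓝 (((1 / (α * (α - 1)) : ℝ) : EReal) * L)) := by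
  refine Tendsto.congr (fun n => (renyiPerStep_eq hα0 hα1 h n).symm) ?_
  exact EReal.Tendsto.const_mul hL (Or.inl (EReal.coe_ne_bot _)) (Or.inl (EReal.coe_ne_top _))

/-- The factor `1 / (α (α - 1))` is positive, so maximal free energy is optimal. If `ν` is not
dominated by `θ`, both sides are `⊤` and `ν` itself attains it, since its relative entropy to `θ` is
`⊤` and to itself finite. -/
theorem renyi_variational_of_one_lt {α : ℝ} (hα : 1 < α) (ν θ : MarkovDist S) :
    ∃ R : EReal, Tendsto (renyiPerStep α ν θ) atTop (𝓝 R) ∧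
      R = (⨆ (μ : MarkovDist S) (_ : μ.AbsCont ν), objective α ν θ μ) ∧
      ∃ μ : MarkovDist S, μ.AbsCont ν ∧ objective α ν θ μ = R ∧
        (ν.AbsCont θ → IsPerronTilt α ν θ μ) := by
  have hα0 : 0 < α := zero_lt_one.trans hα
  suffices H : ∃ R : EReal, Tendsto (renyiPerStep α ν θ) atTop (𝓝 R) ∧
      (∀ μ : MarkovDist S, μ.AbsCont ν → objective α ν θ μ ≤ R) ∧
      ∃ μ : MarkovDist S, μ.AbsCont ν ∧ objective α ν θ μ = R ∧
        (ν.AbsCont θ → IsPerronTilt α ν θ μ) by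
    obtain ⟨R, hR, hle, μ, hμ, hobj, htilt⟩ := H
    exact ⟨R, hR, le_antisymm (hobj ▸ le_iSup₂_of_le μ hμ le_rfl) (iSup₂_le hle), μ, hμ, hobj,
      htilt⟩
  by_cases h : ν.AbsCont θ
  · obtain ⟨r, hr, hlim, hbound, hex⟩ := exists_perron_value hα0.ne' hα.ne' ν θ
    have hr0 : 0 < r := (Real.exp_pos _).trans_le (hbound ν (.refl ν) h)
    obtain ⟨μ, hν, hθ, hfree, htilt⟩ := hex hr0
    rw [ENNReal.log_ofReal_of_pos hr0] at hlim
    have hc : 0 ≤ 1 / (α * (α - 1)) :=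
      one_div_nonneg.2 (mul_nonneg hα0.le (sub_nonneg.2 hα.le))
    refine ⟨_, tendsto_renyiPerStep hα0 hα.ne' (fun _ => h) hlim, fun μ' hμ' => ?_, μ, hν, ?_,
      fun _ => htilt⟩
    · rw [objective_of_absCont hα0.ne' hα.ne' hμ' (hμ'.trans h), ← EReal.coe_mul,
        EReal.coe_le_coe_iff]
      exact mul_le_mul_of_nonneg_left
        ((Real.le_log_iff_exp_le hr0).2 (hbound μ' hμ' (hμ'.trans h))) hc
    · rw [objective_of_absCont hα0.ne' hα.ne' hν hθ, hfree, EReal.coe_mul]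
  · refine ⟨⊤, ?_, fun _ _ => le_top, ν, .refl ν, ?_, fun h' => absurd h' h⟩
    · refine tendsto_const_nhds.congr' ?_
      -- The index `n = 0` concerns a single state, whose law may be dominated even though `ν` is
      -- not; one transition is needed.
      filter_upwards [eventually_ge_atTop 1] with n hn
      obtain ⟨m, rfl⟩ := Nat.exists_eq_add_of_le' hn
      obtain ⟨x, hx, hx'⟩ := exists_pathLaw_ne_zero h m
      rw [renyiPerStep, renyiDiv, if_neg hα0.not_gt, renyiDivPos,
        if_pos ⟨hα, fun hac => hx' (hac x hx)⟩, EReal.coe_mul_top_of_pos (by positivity)]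
    · rw [objective, relEnt_of_absCont (.refl ν), relEnt, if_neg h,
        EReal.coe_mul_top_of_pos (by positivity), ← EReal.coe_mul, EReal.top_sub_coe]

/-- The factor `1 / (α (α - 1))` is negative, so maximal free energy gives an infimum. The value `r
= 0` means that no `μ` is dominated by both chains; the rate is then `⊤`, the infimum over the empty
set. -/
theorem renyi_variational_of_lt_one {α : ℝ} (hα0 : 0 < α) (hα1 : α < 1) (ν θ : MarkovDist S) :
    ∃ R : EReal, Tendsto (renyiPerStep α ν θ) atTop (𝓝 R) ∧
      R = (⨅ (μ : MarkovDist S) (_ : μ.AbsCont ν ∧ μ.AbsCont θ), objective α ν θ μ) ∧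
      ((∃ μ : MarkovDist S, μ.AbsCont ν ∧ μ.AbsCont θ) →
        ∃ μ : MarkovDist S, (μ.AbsCont ν ∧ μ.AbsCont θ) ∧ objective α ν θ μ = R ∧
          IsPerronTilt α ν θ μ) := by
  have hc : 1 / (α * (α - 1)) < 0 :=
    one_div_neg.2 (mul_neg_of_pos_of_neg hα0 (sub_neg.2 hα1))
  obtain ⟨r, hr, hlim, hbound, hex⟩ := exists_perron_value hα0.ne' hα1.ne ν θ
  refine ⟨_, tendsto_renyiPerStep hα0 hα1.ne (fun h => absurd h hα1.not_gt) hlim, ?_⟩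
  rcases hr.eq_or_lt with rfl | hr0
  · have hnone : ¬ ∃ μ : MarkovDist S, μ.AbsCont ν ∧ μ.AbsCont θ := fun ⟨μ, hν, hθ⟩ =>
      (hbound μ hν hθ).not_gt (Real.exp_pos _)
    refine ⟨?_, fun h => absurd h hnone⟩
    rw [ENNReal.ofReal_zero, ENNReal.log_zero, EReal.coe_mul_bot_of_neg hc]
    exact (iInf₂_eq_top.2 fun μ hμ => absurd ⟨μ, hμ⟩ hnone).symm
  · obtain ⟨μ, hν, hθ, hfree, htilt⟩ := hex hr0
    rw [ENNReal.log_ofReal_of_pos hr0]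
    have hobj : objective α ν θ μ = ((1 / (α * (α - 1)) : ℝ) : EReal) * (Real.log r : EReal) := by
      rw [objective_of_absCont hα0.ne' hα1.ne hν hθ, hfree, EReal.coe_mul]
    refine ⟨le_antisymm (le_iInf₂ fun μ' hμ' => ?_) (hobj ▸ iInf₂_le_of_le μ ⟨hν, hθ⟩ le_rfl),
      fun _ => ⟨μ, ⟨hν, hθ⟩, hobj, htilt⟩⟩
    rw [objective_of_absCont hα0.ne' hα1.ne hμ'.1 hμ'.2, ← EReal.coe_mul, EReal.coe_le_coe_iff]
    exact mul_le_mul_of_nonpos_left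
      ((Real.le_log_iff_exp_le hr0).2 (hbound μ' hμ'.1 hμ'.2)) hc.le

theorem tiltedMatrix_one_sub (α : ℝ) (ν θ : MarkovDist S) :
    tiltedMatrix (1 - α) θ ν = tiltedMatrix α ν θ := by
  ext i j
  rw [tiltedMatrix_apply, tiltedMatrix_apply, sub_sub_cancel, mul_comm]

/-- The two terms trade places with opposite signs. Only commutativity of addition is used, so
infinite entropies cause no exception. -/
theorem objective_one_sub (α : ℝ) (ν θ μ : MarkovDist S) :
    objective (1 - α) θ ν μ = objective α ν θ μ := by
  have h1 : 1 / (1 - α) = -(1 / (α - 1)) := by rw [← neg_sub, one_div_neg_eq_neg_one_div]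
  have h2 : 1 / (1 - α - 1) = -(1 / α) := by
    rw [← one_div_neg_eq_neg_one_div]
    ring
  rw [objective, objective, h1, h2, EReal.coe_neg, EReal.coe_neg, EReal.neg_mul, EReal.neg_mul,
    sub_eq_add_neg, neg_neg, add_comm]
  exact (sub_eq_add_neg _ _).symm

theorem renyiPerStep_one_sub {α : ℝ} (hα : α < 0) (ν θ : MarkovDist S) :
    renyiPerStep (1 - α) θ ν = renyiPerStep α ν θ := by
  funext n
  rw [renyiPerStep, renyiPerStep, renyiDiv, renyiDiv, if_pos hα, if_neg (by linarith)]

theorem renyi_variational_of_neg {α : ℝ} (hα : α < 0) (ν θ : MarkovDist S) :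
    ∃ R : EReal, Tendsto (renyiPerStep α ν θ) atTop (𝓝 R) ∧
      R = (⨆ (μ : MarkovDist S) (_ : μ.AbsCont θ), objective α ν θ μ) ∧
      ∃ μ : MarkovDist S, μ.AbsCont θ ∧ objective α ν θ μ = R ∧
        (θ.AbsCont ν → IsPerronTilt α ν θ μ) := by
  have h := renyi_variational_of_one_lt (α := 1 - α) (by linarith) θ ν
  simpa only [renyiPerStep_one_sub hα, objective_one_sub, IsPerronTilt, tiltedMatrix_one_sub]
    using h

end MarkovDist

theorem mainTheorem3 {S : Type*} [Fintype S] (α : ℝ) (hα0 : α ≠ 0) (hα1 : α ≠ 1)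
    (ν θ : MarkovDist S) :
    Tendsto (MarkovDist.renyiPerStep α ν θ) atTop (𝓝 (MarkovDist.renyiRate α ν θ)) ∧
    (1 < α →
      MarkovDist.renyiRate α ν θ =
        (⨆ (μ : MarkovDist S) (_ : μ.AbsCont ν), MarkovDist.objective α ν θ μ) ∧
      ∃ μ : MarkovDist S, μ.AbsCont ν ∧
        MarkovDist.objective α ν θ μ = MarkovDist.renyiRate α ν θ ∧
        (ν.AbsCont θ → MarkovDist.IsPerronTilt α ν θ μ)) ∧
    (0 < α → α < 1 →
      MarkovDist.renyiRate α ν θ =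
        (⨅ (μ : MarkovDist S) (_ : μ.AbsCont ν ∧ μ.AbsCont θ), MarkovDist.objective α ν θ μ) ∧
      ((∃ μ : MarkovDist S, μ.AbsCont ν ∧ μ.AbsCont θ) →
        ∃ μ : MarkovDist S, (μ.AbsCont ν ∧ μ.AbsCont θ) ∧
          MarkovDist.objective α ν θ μ = MarkovDist.renyiRate α ν θ ∧
          MarkovDist.IsPerronTilt α ν θ μ)) ∧
    (α < 0 →
      MarkovDist.renyiRate α ν θ =
        (⨆ (μ : MarkovDist S) (_ : μ.AbsCont θ), MarkovDist.objective α ν θ μ) ∧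
      ∃ μ : MarkovDist S, μ.AbsCont θ ∧
        MarkovDist.objective α ν θ μ = MarkovDist.renyiRate α ν θ ∧
        (θ.AbsCont ν → MarkovDist.IsPerronTilt α ν θ μ)) := by

  rcases lt_or_gt_of_ne hα0 with hneg | hpos
  · obtain ⟨R, hR, h⟩ := MarkovDist.renyi_variational_of_neg hneg ν θ
    have hrate : MarkovDist.renyiRate α ν θ = R := hR.limUnder_eq
    rw [hrate]
    exact ⟨hR, fun h' => absurd h' (by linarith), fun h' => absurd h' hneg.not_gt, fun _ => h⟩
  · rcases lt_or_gt_of_ne hα1 with hlt | hgt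
    · obtain ⟨R, hR, h⟩ := MarkovDist.renyi_variational_of_lt_one hpos hlt ν θ
      have hrate : MarkovDist.renyiRate α ν θ = R := hR.limUnder_eq
      rw [hrate]
      exact ⟨hR, fun h' => absurd h' hlt.not_gt, fun _ _ => h, fun h' => absurd h' hpos.not_gt⟩
    · obtain ⟨R, hR, h⟩ := MarkovDist.renyi_variational_of_one_lt hgt ν θ
      have hrate : MarkovDist.renyiRate α ν θ = R := hR.limUnder_eq
      rw [hrate]
      exact ⟨hR, fun _ => h, fun _ h' => absurd h' hgt.not_gt, fun h' => absurd h' hpos.not_gt⟩
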